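/- Let $X=[x_1\ \cdots\ x_p]\in\mathbb{R}^{n\times p}$, $f:\mathbb{R}^n\to\mathbb{R}\cup\{+\infty\}$ and $\eta>0$, and consider the problem $$\min_{\beta\in\mathbb{R}_+^p}\; f(X\beta)+\eta\,\mathbf 1^T\beta .\qquad (P)$$ Let $r(\beta)=\mathbf 1^T\beta+\delta(\beta;\mathbb{R}_+^p)$, where $\delta(\cdot\,;C)$ is $0$ on $C$ and $+\infty$ off $C$, let $r^\circ(\theta)=\inf\{\lambda\ge 0:\ \langle\beta,\theta\rangle\le\lambda r(\beta)\ \ \forall\beta\}$ be its polar, and put $\mathcal L(\beta)=f(X\beta)+\eta\, r(\beta)-\eta$. For $u\in\operatorname{dom}f=\{u: f(u)<+\infty\}$ let $$\mathrm{d}f(u)(w)=\liminf_{\tau\searrow 0,\ v\to w}\frac{f(u+\tau v)-f(u)}{\tau}$$ be the subderivative. For $\gamma\in[0,1]$ let $f_\gamma(u)=f(u)-\gamma\,\mathrm{d}f(u)(u)$ for $u\in\operatorname{dom}f$ (with $0\cdot(\pm\infty)=0$) and $f_\gamma(u)=+\infty$ otherwise. Let $(f_\gamma)^\star(h)=\sup_u\{\langle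 h,u\rangle-f_\gamma(u)\}$ and $\operatorname{dom}(f_\gamma)^\star=\{h:(f_\gamma)^\star(h)<+\infty\}$. Assume: * the objective $f(X\beta)+\eta\, r(\beta)$ is proper (so (P) is feasible) and lower semicontinuous; * $f$ is subdifferentially regular at every point $u$ of $\operatorname{col}_+(X)=\{X\beta:\beta\in\mathbb{R}_+^p\}$ at which $f(u)<+\infty$, that is, the epigraph of $f$ is Clarke regular at $(u,f(u))$: it is locally closed there, and every limiting normal vector there is a regular (Fréchet) normal vector; * either $X$ has rank $n$, or $f$ is convex and $\operatorname{dom}f$ cannot be separated from the range of $X$, i.e. there is no hyperplane for which these two sets lie in opposite closed half-spaces. Then for every local minimum $\beta^\star$ of (P), every $\gamma\in[0,1]$ and every $h\in\operatorname{dom}(f_\gamma)^\star$, $$\mathcal L(\beta^\star)\ \ge\ \bigl[-(f_\gamma)^\star(h)-\overline\eta-\gamma\eta\bigr]+(1-\mathbf 1^T\beta^\star)\bigl[\overline\eta-(1-\gamma)\eta\bigr],\qquad \overline\eta=r^\circ(-X^Th).$$ For $p\ge 1$ the same inequality also holds with $\overline\eta=\max_{1\le i\le p}(-\langle x_i,h\rangle)$,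 which differs from $r^\circ(-X^Th)$ only when this maximum is negative. -/

import Mathlib

open Filter Topology

namespace GaugeReg

noncomputable section

/-- `ℝⁿ` with its Euclidean inner product. -/
abbrev Vec (n : ℕ) := EuclideanSpace ℝ (Fin n)

/-! ### Extended-real-valued functions -/

/-- A function with values in `[-∞, ∞]` is proper if it never takes the value `-∞` and is not
identically `+∞`. -/
def IsProper {E : Type*} (g : E → EReal) : Prop :=
  (∀ x, g x ≠ ⊥) ∧ ∃ x, g x ≠ ⊤

/-- The effective domain `{x : g x < +∞}`. -/
def effDom {E : Type*} (g : E → EReal) : Set E := {x | g x < ⊤}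

open Classical in
/-- The indicator function `δ(· ; C)`: `0` on `C` and `+∞` off `C`. -/
def indicatorFn {E : Type*} (C : Set E) (x : E) : EReal := if x ∈ C then 0 else ⊤

section InnerProduct

variable {E : Type*} [NormedAddCommGroup E] [InnerProductSpace ℝ E]

/-- The epigraph of `g`, in the Euclidean product `E × ℝ`. -/
def epigraph (g : E → EReal) : Set (WithLp 2 (E × ℝ)) := {z | g z.fst ≤ (z.snd : EReal)}

/-- An extended-real-valued function is convex if its epigraph is convex. -/
def IsConvexFn (g : E → EReal) : Prop := Convex ℝ (epigraph g)

/-- The convex conjugate `g⋆(h) = sup_u (⟨h, u⟩ - g u)`. -/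
def conjugate (g : E → EReal) (h : E) : EReal :=
  ⨆ u : E, ((inner ℝ h u : ℝ) : EReal) - g u

/-- The subderivative
`dg(u)(w) = liminf_{τ ↘ 0, v → w} (g (u + τ v) - g u) / τ`, meant for `u` with `g u` finite. -/
def subderiv (g : E → EReal) (u w : E) : EReal :=
  liminf (fun q : ℝ × E => ((q.1⁻¹ : ℝ) : EReal) * (g (u + q.1 • q.2) - g u))
    (𝓝[>] (0 : ℝ) ×ˢ 𝓝 w)

open Classical in
/-- `g_γ(u) = g u - γ · dg(u)(u)` for `u` in the domain of `g`, and `+∞` off the domain. The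
product `0 · (±∞)` is `0`, so that `g_0 = g`. -/
def radialShift (g : E → EReal) (γ : ℝ) (u : E) : EReal :=
  if g u = ⊤ then ⊤ else g u - (γ : EReal) * subderiv g u u

/-- Regular normals to `C` at `x`: `⟨v, y - x⟩ ≤ o(‖y - x‖)` for `y ∈ C`. -/
def regularNormals (C : Set E) (x : E) : Set E :=
  {v | ∀ ε : ℝ, 0 < ε → ∀ᶠ y in 𝓝[C] x, inner ℝ v (y - x) ≤ ε * ‖y - x‖}

/-- (General, or limiting) normals to `C` at `x`: limits of regular normals to `C` at points of `C`
that converge to `x`. -/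
def limitingNormals (C : Set E) (x : E) : Set E :=
  {v | ∃ (y : ℕ → E) (w : ℕ → E), (∀ k, y k ∈ C) ∧ Tendsto y atTop (𝓝 x) ∧
    (∀ k, w k ∈ regularNormals C (y k)) ∧ Tendsto w atTop (𝓝 v)}

/-- `C` is Clarke regular at `x ∈ C`: it is locally closed at `x`, and every normal to `C` at `x`
is a regular normal. -/
def IsClarkeRegularAt (C : Set E) (x : E) : Prop :=
  x ∈ C ∧ (∃ V ∈ 𝓝 x, IsClosed V ∧ IsClosed (C ∩ V)) ∧
    limitingNormals C x = regularNormals C x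

/-- `g` is subdifferentially regular at `u`: `g u` is finite and the epigraph of `g` is Clarke
regular at `(u, g u)`. -/
def IsSubdiffRegularAt (g : E → EReal) (u : E) : Prop :=
  ∃ a : ℝ, g u = (a : EReal) ∧ IsClarkeRegularAt (epigraph g) (WithLp.toLp 2 (u, a))

/-- `C` and `D` can be separated: they lie in opposite closed half-spaces of some hyperplane. -/
def CanBeSeparated (C D : Set E) : Prop :=
  ∃ (a : E) (b : ℝ), a ≠ 0 ∧ (∀ x ∈ C, inner ℝ a x ≤ b) ∧ (∀ y ∈ D, b ≤ inner ℝ a y)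

/-- The polar `r°(θ) = inf {l ≥ 0 : ⟨β, θ⟩ ≤ l · r β for all β}` of a gauge `r`. -/
def polarGauge (r : E → EReal) (θ : E) : EReal :=
  sInf ((fun l : ℝ => (l : EReal)) ''
    {l : ℝ | 0 ≤ l ∧ ∀ β : E, ((inner ℝ β θ : ℝ) : EReal) ≤ (l : EReal) * r β})

end InnerProduct

/-! ### The regularized problem -/

/-- The nonnegative orthant `ℝ₊ᵖ`. -/
def orthant (p : ℕ) : Set (Vec p) := {β | ∀ i, 0 ≤ β i}

/-- The gauge `r β = 1ᵀβ + δ(β; ℝ₊ᵖ)`. -/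
def simplexGauge (p : ℕ) (β : Vec p) : EReal :=
  ((∑ i, β i : ℝ) : EReal) + indicatorFn (orthant p) β

/-- The product `X β`. -/
def app {n p : ℕ} (X : Matrix (Fin n) (Fin p) ℝ) (β : Vec p) : Vec n :=
  WithLp.toLp 2 (X.mulVec β.ofLp)

/-- The cone `col₊(X) = {X β : β ∈ ℝ₊ᵖ}`. -/
def colPos {n p : ℕ} (X : Matrix (Fin n) (Fin p) ℝ) : Set (Vec n) := app X '' orthant p

/-- The objective `f (X β) + η r β`, which is `f (X β) + η 1ᵀβ` on `ℝ₊ᵖ` and `+∞` elsewhere. -/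
def objective {n p : ℕ} (f : Vec n → EReal) (X : Matrix (Fin n) (Fin p) ℝ) (η : ℝ) (β : Vec p) :
    EReal :=
  f (app X β) + (η : EReal) * simplexGauge p β

/-- `L(β) = f (X β) + η r β - η`. -/
def lagr {n p : ℕ} (f : Vec n → EReal) (X : Matrix (Fin n) (Fin p) ℝ) (η : ℝ) (β : Vec p) :
    EReal :=
  objective f X η β - (η : EReal)

/-- `β` is a local minimum of `f (X β) + η 1ᵀβ` subject to `β ∈ ℝ₊ᵖ`. -/
def IsLocalSolution {n p : ℕ} (f : Vec n → EReal) (X : Matrix (Fin n) (Fin p) ℝ) (η : ℝ)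
    (β : Vec p) : Prop :=
  β ∈ orthant p ∧
    IsLocalMinOn (fun b : Vec p => f (app X b) + ((η * ∑ i, b i : ℝ) : EReal)) (orthant p) β

/-- `[-(f_γ)⋆(h) - e - γ η] + (1 - 1ᵀβ) [e - (1 - γ) η]`. -/
def lowerBound {n p : ℕ} (f : Vec n → EReal) (η γ : ℝ) (h : Vec n) (e : EReal) (β : Vec p) :
    EReal :=
  (-conjugate (radialShift f γ) h - e - ((γ * η : ℝ) : EReal)) +
    ((1 - ∑ i, β i : ℝ) : EReal) * (e - (((1 - γ) * η : ℝ) : EReal))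

end

end GaugeReg

/-!
Write `u⋆ = X β⋆`, `a = f u⋆` and `s = 1ᵀβ⋆`. If `a = +∞` there is nothing to prove. Otherwise the
products in the lower bound expand, and for a real `e` the claim becomes
`f_γ⋆(h) ≥ -a - γ η s - e s`. The polar inequality `⟨β⋆, -Xᵀh⟩ ≤ e s` gives `⟨h, u⋆⟩ ≥ -e s`, both
for `e = r°(-Xᵀh)` (`exists_polarGauge_eq_coe`) and for the largest entry of `-Xᵀh`, so it suffices
that `f_γ⋆(h) ≥ ⟨h, u⋆⟩ - a - γ η s` (`le_conjugate_radialShift`).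

This would follow by testing the conjugate at `u⋆` if `df(u⋆)(u⋆) ≥ -η s`, the first-order condition
along the ray through `u⋆`. The subderivative, however, looks at all directions near `u⋆`, also those
that leave `col₊(X)`, so the exact condition needs a constraint qualification for the orthant. Since
the conjugate is a supremum, an approximate condition is enough: there are `u → u⋆` with `f u → a`
and `liminf df(u)(u) ≥ -η s` (`exists_near_neg_le_subderiv`). These `u` come from the penalty method
(`exists_isMinOn_add_penalty`): on a small compact piece of `epi f × ℝ₊ᵖ` around `(u⋆, a, β⋆)`, closed
because `epi f` is locally closed at `(u⋆, a)`, minimize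
`α + η 1ᵀβ + ‖β - β⋆‖² + k ‖u - X β‖²`. As `k` grows, minimizers converge to `(u⋆, a, β⋆)` and
`k ‖u - X β‖²` tends to `0`. Comparing a minimizer with `(u + τ v, α + τ c, (1 + τ) β)` for `τ ↘ 0`
and `v → u` bounds `df(u)(u)` from below by `-η 1ᵀβ - 2 ⟨β - β⋆, β⟩ - 2 k ‖u - X β‖²`.
-/

open Filter Topology

namespace GaugeReg

/-! ### The penalty method -/

/-- Minimizers of the penalized functions `g + k P` over a compact set approach the unique
minimizer of `g` on the zero set of `P`, and their penalties `k P` tend to zero. -/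
lemma exists_isMinOn_add_penalty {Z : Type*} [MetricSpace Z] {K : Set Z} (hK : IsCompact K)
    {g P : Z → ℝ} (hg : Continuous g) (hP : Continuous P) (hP0 : ∀ z, 0 ≤ P z) {z₀ : Z}
    (hz₀ : z₀ ∈ K) (hPz₀ : P z₀ = 0) (huniq : ∀ z ∈ K, P z = 0 → g z ≤ g z₀ → z = z₀)
    {U : Set Z} (hU : U ∈ 𝓝 z₀) {ε : ℝ} (hε : 0 < ε) :
    ∃ k : ℝ, ∃ z ∈ K, z ∈ U ∧ IsMinOn (fun z => g z + k * P z) K z ∧ k * P z < ε := by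
  have hmin : ∀ k : ℕ, ∃ z ∈ K, IsMinOn (fun z => g z + k * P z) K z := fun k =>
    hK.exists_isMinOn ⟨z₀, hz₀⟩ (by fun_prop)
  choose z hzK hz using hmin
  have hle : ∀ k, g (z k) + k * P (z k) ≤ g z₀ := fun k => by
    simpa [hPz₀] using hz k hz₀
  obtain ⟨y, hyK, φ, hφ, hlim⟩ := hK.tendsto_subseq hzK
  have hgl : Tendsto (fun j => g (z (φ j))) atTop (𝓝 (g y)) := (hg.tendsto y).comp hlim
  have hPl : Tendsto (fun j => P (z (φ j))) atTop (𝓝 (P y)) := (hP.tendsto y).comp hlim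
  have hφ' : Tendsto (fun j => ((φ j : ℕ) : ℝ)) atTop atTop :=
    tendsto_natCast_atTop_atTop.comp hφ.tendsto_atTop
  have hgy : g y ≤ g z₀ := le_of_tendsto hgl <| Eventually.of_forall fun j => by
    have := hle (φ j)
    have := mul_nonneg (Nat.cast_nonneg (α := ℝ) (φ j)) (hP0 (z (φ j)))
    linarith
  have hPy : P y = 0 := by
    by_contra hne
    have hpos : 0 < P y := lt_of_le_of_ne (hP0 y) (Ne.symm hne)
    have h1 : Tendsto (fun j => g (z (φ j)) + (φ j : ℝ) * P (z (φ j))) atTop atTop :=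
      hgl.add_atTop (hφ'.atTop_mul_pos hpos hPl)
    obtain ⟨j, hj⟩ := (h1.eventually_gt_atTop (g z₀)).exists
    exact absurd (hle (φ j)) (not_le.2 hj)
  obtain rfl := huniq y hyK hPy hgy
  have hsmall : ∀ᶠ j in atTop, g y - g (z (φ j)) < ε := by
    have : Tendsto (fun j => g y - g (z (φ j))) atTop (𝓝 (g y - g y)) := hgl.const_sub _
    rw [sub_self] at this
    exact this.eventually_lt_const hε
  obtain ⟨j, hj1, hj2⟩ := ((hlim.eventually hU).and hsmall).exists
  refine ⟨φ j, z (φ j), hzK _, hj1, hz _, ?_⟩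
  have := hle (φ j)
  linarith

/-! ### Lower bounds for the subderivative -/

lemma le_subderiv_of_eventually_lt {E : Type*} [NormedAddCommGroup E] [InnerProductSpace ℝ E]
    {g : E → EReal} {u w : E} {b c : ℝ} (hb : g u = (b : EReal))
    (hev : ∀ᶠ q : ℝ × E in 𝓝[>] (0 : ℝ) ×ˢ 𝓝 w,
      ((b + q.1 * c : ℝ) : EReal) < g (u + q.1 • q.2)) :
    (c : EReal) ≤ subderiv g u w := by
  refine le_liminf_of_le (by isBoundedDefault) ?_
  have hpos : ∀ᶠ q : ℝ × E in 𝓝[>] (0 : ℝ) ×ˢ 𝓝 w, 0 < q.1 :=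
    (eventually_mem_nhdsWithin (a := (0 : ℝ)) (s := Set.Ioi 0)).prod_inl _
  filter_upwards [hev, hpos] with q hq hq0
  rw [hb]
  generalize g (u + q.1 • q.2) = y at hq
  induction y with
  | bot => simp at hq
  | top =>
    rw [EReal.top_sub_coe, EReal.coe_mul_top_of_pos (inv_pos.2 hq0)]
    exact le_top
  | coe y =>
    have hq' := EReal.coe_lt_coe_iff.1 hq
    rw [← EReal.coe_sub, ← EReal.coe_mul, EReal.coe_le_coe_iff, inv_mul_eq_div, le_div_iff₀ hq0]
    linarith

/-! ### The matrix product and the nonnegative orthant -/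

section Linear

variable {n p : ℕ} (X : Matrix (Fin n) (Fin p) ℝ)

lemma continuous_app : Continuous (app X) := by
  unfold app
  fun_prop

lemma app_smul (c : ℝ) (β : Vec p) : app X (c • β) = c • app X β := by
  simp [app, Matrix.mulVec_smul]

lemma inner_app (h : Vec n) (β : Vec p) :
    inner ℝ h (app X β) = inner ℝ β (app X.transpose h) := by
  simp only [app, EuclideanSpace.inner_eq_star_dotProduct, star_trivial]
  rw [Matrix.mulVec_transpose, dotProduct_comm, Matrix.dotProduct_mulVec]

lemma isClosed_orthant : IsClosed (orthant p) := by
  simp only [orthant, Set.ofPred_forall]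
  exact isClosed_iInter fun i => isClosed_le continuous_const (by fun_prop)

end Linear

lemma simplexGauge_of_mem {p : ℕ} {β : Vec p} (hβ : β ∈ orthant p) :
    simplexGauge p β = ((∑ i, β i : ℝ) : EReal) := by
  simp [simplexGauge, indicatorFn, hβ]

lemma simplexGauge_of_notMem {p : ℕ} {β : Vec p} (hβ : β ∉ orthant p) :
    simplexGauge p β = ⊤ := by
  rw [simplexGauge, indicatorFn, if_neg hβ, EReal.coe_add_top]

/-- The polar of the gauge is a real number, and the polar inequality holds for it. The infimum
need not be attained: for `l = 0` the constraint at a point off the orthant reads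
`⟨β, θ⟩ ≤ 0 * ⊤ = 0`. -/
lemma exists_polarGauge_eq_coe {p : ℕ} (θ : Vec p) :
    ∃ e : ℝ, polarGauge (simplexGauge p) θ = (e : EReal) ∧
      ∀ β ∈ orthant p, inner ℝ β θ ≤ e * ∑ i, β i := by
  set S : Set ℝ := {l : ℝ | 0 ≤ l ∧
    ∀ β : Vec p, ((inner ℝ β θ : ℝ) : EReal) ≤ (l : EReal) * simplexGauge p β} with hS
  have hnn : (0 : ℝ) ≤ ∑ i, |θ i| := Finset.sum_nonneg fun i _ => abs_nonneg _
  have hmem : (∑ i, |θ i|) + 1 ∈ S := by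
    refine ⟨by linarith, fun β => ?_⟩
    by_cases hβ : β ∈ orthant p
    · rw [simplexGauge_of_mem hβ, ← EReal.coe_mul, EReal.coe_le_coe_iff, Finset.mul_sum]
      rw [PiLp.inner_apply]
      refine Finset.sum_le_sum fun i _ => ?_
      have h1 : |θ i| ≤ ∑ j, |θ j| :=
        Finset.single_le_sum (f := fun j => |θ j|) (fun j _ => abs_nonneg _) (Finset.mem_univ i)
      have h2 : θ i ≤ (∑ j, |θ j|) + 1 := by linarith [le_abs_self (θ i)]
      simpa [mul_comm] using mul_le_mul_of_nonneg_right h2 (hβ i)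
    · rw [simplexGauge_of_notMem hβ, EReal.coe_mul_top_of_pos (by linarith)]
      exact le_top
  have hlow : ∀ l ∈ S, ∀ β ∈ orthant p, inner ℝ β θ ≤ l * ∑ i, β i := fun l hl β hβ => by
    have := hl.2 β
    rwa [simplexGauge_of_mem hβ, ← EReal.coe_mul, EReal.coe_le_coe_iff] at this
  have hle : ∀ l ∈ S, polarGauge (simplexGauge p) θ ≤ (l : EReal) := fun l hl =>
    sInf_le ⟨l, hl, rfl⟩
  have hge : ∀ c : ℝ, (∀ l ∈ S, c ≤ l) → (c : EReal) ≤ polarGauge (simplexGauge p) θ := by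
    intro c hc
    refine le_sInf ?_
    rintro _ ⟨l, hl, rfl⟩
    exact EReal.coe_le_coe_iff.2 (hc l hl)
  have h0 := hge 0 fun l hl => hl.1
  have h1 := hle _ hmem
  obtain ⟨e, he⟩ : ∃ e : ℝ, polarGauge (simplexGauge p) θ = (e : EReal) :=
    ⟨_, (EReal.coe_toReal (ne_top_of_le_ne_top (EReal.coe_ne_top _) h1)
      (ne_bot_of_le_ne_bot (EReal.coe_ne_bot _) h0)).symm⟩
  refine ⟨e, he, fun β hβ => ?_⟩
  rcases (Finset.sum_nonneg fun i _ => hβ i : 0 ≤ ∑ i, β i).eq_or_lt with hs | hs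
  · have := hlow _ hmem β hβ
    rw [← hs] at this ⊢
    simpa using this
  · rw [← div_le_iff₀ hs, ← EReal.coe_le_coe_iff, ← he]
    exact hge _ fun l hl => (div_le_iff₀ hs).2 (hlow l hl β hβ)

/-! ### Approximate stationarity along the ray -/

/-- Near the image `X β⋆` of a local solution there are points `u`, with `f u` near `f (X β⋆)`, at
which the radial subderivative `df(u)(u)` is almost at least `-η 1ᵀβ⋆`. These points come from
minimizers of the penalized problem in which the constraint `u = X β` is relaxed; such a minimizer
is compared with the points obtained by moving `β` and `u` simultaneously along their rays. They
exist because the epigraph is locally closed. At `X β⋆` itself the inequality may fail even for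
`X = 1` and `f` convex: take `f (x, y) = -M x` with `M > η` on `{y ≤ -(x - 1)²}`, `f = +∞` off this
set, and `β⋆ = (1, 0)`. -/
lemma exists_near_neg_le_subderiv {n p : ℕ} {X : Matrix (Fin n) (Fin p) ℝ} {f : Vec n → EReal}
    {η : ℝ} {βs : Vec p} (hβ : IsLocalSolution f X η βs) {a : ℝ}
    (ha : f (app X βs) = (a : EReal)) {V : Set (WithLp 2 (Vec n × ℝ))}
    (hV : V ∈ 𝓝 (WithLp.toLp 2 (app X βs, a))) (hVc : IsClosed (epigraph f ∩ V))
    {ε : ℝ} (hε : 0 < ε) :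
    ∃ (u : Vec n) (b : ℝ), f u = (b : EReal) ∧ dist u (app X βs) < ε ∧ |b - a| < ε ∧
      ((-(η * ∑ i, βs i + ε) : ℝ) : EReal) ≤ subderiv f u u := by
  obtain ⟨hβo, hloc⟩ := hβ
  set w₀ : WithLp 2 (Vec n × ℝ) := WithLp.toLp 2 (app X βs, a) with hw₀
  set z₀ : WithLp 2 (Vec n × ℝ) × Vec p := (w₀, βs) with hz₀
  have hX := continuous_app X
  -- a closed ball on which `V` and the local minimality are available
  obtain ⟨r, hr, hrV, hrmin⟩ : ∃ r > 0, Metric.closedBall w₀ r ⊆ V ∧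
      ∀ β ∈ Metric.closedBall βs r, β ∈ orthant p →
        f (app X βs) + ((η * ∑ i, βs i : ℝ) : EReal) ≤
          f (app X β) + ((η * ∑ i, β i : ℝ) : EReal) := by
    have h1 := Metric.nhds_basis_closedBall.mem_iff.1 hV
    obtain ⟨r₁, hr₁, hs₁⟩ := h1
    obtain ⟨r₂, hr₂, hs₂⟩ :=
      Metric.nhds_basis_closedBall.mem_iff.1 (eventually_nhdsWithin_iff.1 hloc)
    exact ⟨min r₁ r₂, lt_min hr₁ hr₂,
      (Metric.closedBall_subset_closedBall (min_le_left _ _)).trans hs₁,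
      fun β hb hbo => hs₂ (Metric.closedBall_subset_closedBall (min_le_right _ _) hb) hbo⟩
  set K : Set (WithLp 2 (Vec n × ℝ) × Vec p) :=
    Metric.closedBall z₀ r ∩ (epigraph f ×ˢ orthant p)
  have hdist : ∀ {z}, z ∈ Metric.closedBall z₀ r →
      z.1 ∈ Metric.closedBall w₀ r ∧ z.2 ∈ Metric.closedBall βs r := fun {z} hz => by
    rwa [hz₀, ← closedBall_prod_same] at hz
  have hK : IsCompact K := by
    have hKeq : K = Metric.closedBall z₀ r ∩ ((epigraph f ∩ V) ×ˢ orthant p) := by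
      ext z
      constructor
      · rintro ⟨h1, h2, h3⟩
        exact ⟨h1, ⟨h2, hrV (hdist h1).1⟩, h3⟩
      · rintro ⟨h1, ⟨h2, -⟩, h3⟩
        exact ⟨h1, h2, h3⟩
    rw [hKeq]
    exact (isCompact_closedBall z₀ r).inter_right (hVc.prod isClosed_orthant)
  have hz₀K : z₀ ∈ K :=
    ⟨Metric.mem_closedBall_self hr.le, by simp [epigraph, hz₀, hw₀, ha], hβo⟩
  let g : WithLp 2 (Vec n × ℝ) × Vec p → ℝ :=
    fun z => z.1.snd + η * ∑ i, z.2 i + ‖z.2 - βs‖ ^ 2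
  let P : WithLp 2 (Vec n × ℝ) × Vec p → ℝ := fun z => ‖z.1.fst - app X z.2‖ ^ 2
  have hg : Continuous g := by fun_prop
  have hP : Continuous P := by fun_prop
  have huniq : ∀ z ∈ K, P z = 0 → g z ≤ g z₀ → z = z₀ := by
    rintro ⟨w, β⟩ ⟨hzb, hzf, hzo⟩ hPz hgz
    have hw : w.fst = app X β := by simpa [P, sub_eq_zero] using hPz
    have hβr : β ∈ Metric.closedBall βs r := (hdist hzb).2
    have h1 := hrmin β hβr hzo
    have hzf' : f (app X β) ≤ (w.snd : EReal) := by
      have : f w.fst ≤ (w.snd : EReal) := hzf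
      rwa [hw] at this
    have h2 : a + η * ∑ i, βs i ≤ w.snd + η * ∑ i, β i := by
      rw [ha] at h1
      have := h1.trans (add_le_add_left hzf' _)
      exact_mod_cast this
    have h3 : w.snd + η * ∑ i, β i + ‖β - βs‖ ^ 2 ≤ a + η * ∑ i, βs i := by
      simpa [g, hz₀, hw₀] using hgz
    have h4 : ‖β - βs‖ = 0 := by
      have := sq_nonneg ‖β - βs‖
      exact pow_eq_zero_iff (two_ne_zero) |>.1 (by linarith)
    have h5 : β = βs := by simpa [sub_eq_zero] using h4
    subst h5
    have h6 : w.snd = a := by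
      have : a ≤ w.snd := by
        have := hzf'
        rw [ha] at this
        exact_mod_cast this
      rw [h4] at h3
      linarith
    refine Prod.ext ?_ rfl
    change w = w₀
    rw [hw₀, ← hw, ← h6]
    rfl
  -- the neighbourhood of `z₀` in which the minimizer is sought
  have hU : {z : WithLp 2 (Vec n × ℝ) × Vec p | dist z z₀ < r ∧
      dist z.1.fst (app X βs) < ε ∧ |z.1.snd - a| < ε ∧
      η * ∑ i, z.2 i + 2 * inner ℝ (z.2 - βs) z.2 < η * ∑ i, βs i + ε / 2} ∈ 𝓝 z₀ := by
    have c1 : Continuous fun z : WithLp 2 (Vec n × ℝ) × Vec p => dist z z₀ := by fun_prop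
    have c2 : Continuous fun z : WithLp 2 (Vec n × ℝ) × Vec p => dist z.1.fst (app X βs) := by
      fun_prop
    have c3 : Continuous fun z : WithLp 2 (Vec n × ℝ) × Vec p => |z.1.snd - a| := by fun_prop
    have c4 : Continuous fun z : WithLp 2 (Vec n × ℝ) × Vec p =>
      η * ∑ i, z.2 i + 2 * inner ℝ (z.2 - βs) z.2 := by fun_prop
    refine ((c1.tendsto z₀).eventually_lt_const ?_).and
      (((c2.tendsto z₀).eventually_lt_const ?_).and
      (((c3.tendsto z₀).eventually_lt_const ?_).and ((c4.tendsto z₀).eventually_lt_const ?_)))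
    · simpa using hr
    · simpa [hz₀, hw₀] using hε
    · simpa [hz₀, hw₀] using hε
    · simpa [hz₀] using hε
  obtain ⟨k, ⟨w, β⟩, ⟨-, hzf, hzo⟩, ⟨hzr, hzu, hzb, hzβ⟩, hmin, hkP⟩ :=
    exists_isMinOn_add_penalty hK hg hP (fun z => sq_nonneg _) hz₀K (by simp [P, hz₀, hw₀])
      huniq hU (show 0 < ε / 4 by linarith)
  set u := w.fst with hu
  set b := w.snd with hb
  have hweta : WithLp.toLp 2 (w.fst, w.snd) = w := rfl
  simp only at hzu hzb hzβ
  -- curves starting at the minimizer stay in the closed ball for a short time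
  have hnear : ∀ {F : Filter (ℝ × Vec n)} {G : ℝ × Vec n → WithLp 2 (Vec n × ℝ) × Vec p},
      Tendsto G F (𝓝 (w, β)) → ∀ᶠ q in F, G q ∈ Metric.closedBall z₀ r := fun hG =>
    hG.eventually (Metric.isOpen_ball.mem_nhds hzr |> fun h =>
      mem_of_superset h Metric.ball_subset_closedBall)
  have hfub : f u ≤ (b : EReal) := hzf
  have hfu : f u = (b : EReal) := by
    refine le_antisymm hfub (not_lt.1 fun hlt => ?_)
    obtain ⟨b', hb'1, hb'2⟩ := EReal.lt_iff_exists_real_btwn.1 hlt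
    have hb'b : b' < b := EReal.coe_lt_coe_iff.1 hb'2
    -- lowering the height of `w` towards `b'` decreases the penalized objective
    have hcont : Continuous fun q : ℝ × Vec n =>
        ((WithLp.toLp 2 (u, b + q.1 * (b' - b)), β) : WithLp 2 (Vec n × ℝ) × Vec p) := by
      fun_prop
    have hG := hcont.tendsto (0, 0)
    rw [show ((WithLp.toLp 2 (u, b + (0 : ℝ) * (b' - b)), β) :
      WithLp 2 (Vec n × ℝ) × Vec p) = (w, β) by rw [← hweta]; simp [hu, hb]] at hG
    have h1 : ∀ᶠ q : ℝ × Vec n in 𝓝[>] (0 : ℝ) ×ˢ 𝓝 0, 0 < q.1 :=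
      (eventually_mem_nhdsWithin (a := (0 : ℝ)) (s := Set.Ioi 0)).prod_inl _
    have h2 : ∀ᶠ q : ℝ × Vec n in 𝓝[>] (0 : ℝ) ×ˢ 𝓝 0, q.1 < 1 :=
      (eventually_nhdsWithin_of_eventually_nhds (eventually_lt_nhds one_pos)).prod_inl _
    have h3 := hnear (hG.mono_left (by
      rw [nhds_prod_eq]; exact prod_mono nhdsWithin_le_nhds le_rfl :
        𝓝[>] (0 : ℝ) ×ˢ 𝓝 (0 : Vec n) ≤ 𝓝 ((0 : ℝ), (0 : Vec n))))
    obtain ⟨q, hq0, hq1, hq⟩ := (h1.and (h2.and h3)).exists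
    have hqK := hmin ⟨hq, (hb'1.le.trans (EReal.coe_le_coe_iff.2 (by nlinarith)) :
      f u ≤ ((b + q.1 * (b' - b) : ℝ) : EReal)), hzo⟩
    have : b ≤ b + q.1 * (b' - b) := by simpa [g, P, ← hu, ← hb] using hqK
    nlinarith
  refine ⟨u, b, hfu, hzu, hzb, le_subderiv_of_eventually_lt hfu ?_⟩
  set c := -(η * ∑ i, βs i + ε) with hc
  have hcont : Continuous fun q : ℝ × Vec n =>
      ((WithLp.toLp 2 (u + q.1 • q.2, b + q.1 * c), (1 + q.1) • β) :
        WithLp 2 (Vec n × ℝ) × Vec p) := by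
    fun_prop
  have hG := hcont.tendsto (0, u)
  rw [show ((WithLp.toLp 2 (u + (0 : ℝ) • u, b + (0 : ℝ) * c), (1 + (0 : ℝ)) • β) :
    WithLp 2 (Vec n × ℝ) × Vec p) = (w, β) by rw [← hweta]; simp [hu, hb]] at hG
  have hfil : 𝓝[>] (0 : ℝ) ×ˢ 𝓝 u ≤ 𝓝 ((0 : ℝ), u) := by
    rw [nhds_prod_eq]; exact prod_mono nhdsWithin_le_nhds le_rfl
  have h1 : ∀ᶠ q : ℝ × Vec n in 𝓝[>] (0 : ℝ) ×ˢ 𝓝 u, 0 < q.1 :=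
    (eventually_mem_nhdsWithin (a := (0 : ℝ)) (s := Set.Ioi 0)).prod_inl _
  -- the difference quotient of the penalized objective along the curve is eventually negative
  have h2 : ∀ᶠ q : ℝ × Vec n in 𝓝[>] (0 : ℝ) ×ˢ 𝓝 u,
      c + η * ∑ i, β i + (2 * inner ℝ (β - βs) β + q.1 * ‖β‖ ^ 2) +
        k * (2 * inner ℝ (u - app X β) (q.2 - app X β) + q.1 * ‖q.2 - app X β‖ ^ 2) < 0 := by
    refine hfil (Tendsto.eventually_lt_const ?_ (Continuous.tendsto (by fun_prop) _))
    have hkP' : k * ‖u - app X β‖ ^ 2 < ε / 4 := hkP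
    simp only [real_inner_self_eq_norm_sq]
    rw [hc]
    linarith
  filter_upwards [h1, h2, hnear (hG.mono_left hfil)] with q hq0 hq hqb
  by_contra hcon
  have hqo : (1 + q.1) • β ∈ orthant p := fun i => by
    have := hzo i
    simpa using mul_nonneg (by linarith : (0 : ℝ) ≤ 1 + q.1) this
  have hqK := hmin ⟨hqb, (not_lt.1 hcon : f (u + q.1 • q.2) ≤ ((b + q.1 * c : ℝ) : EReal)), hqo⟩
  have hqK' : b + η * ∑ i, β i + ‖β - βs‖ ^ 2 + k * ‖u - app X β‖ ^ 2 ≤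
      b + q.1 * c + η * ∑ i, ((1 + q.1) • β) i + ‖(1 + q.1) • β - βs‖ ^ 2 +
        k * ‖u + q.1 • q.2 - app X ((1 + q.1) • β)‖ ^ 2 := hqK
  have e1 : ∑ i, ((1 + q.1) • β) i = (1 + q.1) * ∑ i, β i := by
    simp [Finset.mul_sum]
  have e2 : ‖(1 + q.1) • β - βs‖ ^ 2 =
      ‖β - βs‖ ^ 2 + q.1 * (2 * inner ℝ (β - βs) β + q.1 * ‖β‖ ^ 2) := by
    rw [show (1 + q.1) • β - βs = (β - βs) + q.1 • β by module, norm_add_sq_real,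
      inner_smul_right, norm_smul, mul_pow, Real.norm_eq_abs, sq_abs]
    ring
  have e3 : ‖u + q.1 • q.2 - app X ((1 + q.1) • β)‖ ^ 2 = ‖u - app X β‖ ^ 2 +
      q.1 * (2 * inner ℝ (u - app X β) (q.2 - app X β) + q.1 * ‖q.2 - app X β‖ ^ 2) := by
    rw [app_smul, show u + q.1 • q.2 - (1 + q.1) • app X β =
      (u - app X β) + q.1 • (q.2 - app X β) by module, norm_add_sq_real,
      inner_smul_right, norm_smul, mul_pow, Real.norm_eq_abs, sq_abs]
    ring
  rw [e1, e2, e3] at hqK'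
  have := mul_neg_of_pos_of_neg hq0 hq
  linarith

/-! ### The conjugate and the lower bound -/

/-- The conjugate inequality in which `-η 1ᵀβ⋆` takes the place of `df(X β⋆)(X β⋆)`. -/
lemma le_conjugate_radialShift {n p : ℕ} {X : Matrix (Fin n) (Fin p) ℝ} {f : Vec n → EReal}
    {η : ℝ} {βs : Vec p} (hβ : IsLocalSolution f X η βs) {a : ℝ}
    (ha : f (app X βs) = (a : EReal)) (hreg : IsSubdiffRegularAt f (app X βs)) {γ : ℝ}
    (hγ : 0 ≤ γ) (h : Vec n) :
    ((inner ℝ h (app X βs) - a - γ * (η * ∑ i, βs i) : ℝ) : EReal) ≤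
      conjugate (radialShift f γ) h := by
  obtain ⟨a', ha', -, ⟨V, hV, -, hVc⟩, -⟩ := hreg
  obtain rfl : a = a' := EReal.coe_injective (ha.symm.trans ha')
  refine EReal.ge_of_forall_gt_iff_ge.1 fun y hy => ?_
  have hy' := EReal.coe_lt_coe_iff.1 hy
  have hD : 0 < ‖h‖ + 1 + γ := by positivity
  obtain ⟨u, b, hfu, hu, hb, hsub⟩ := exists_near_neg_le_subderiv hβ ha hV hVc
    (div_pos (sub_pos.2 hy') hD)
  set ε := (inner ℝ h (app X βs) - a - γ * (η * ∑ i, βs i) - y) / (‖h‖ + 1 + γ) with hε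
  have hεD : ε * (‖h‖ + 1 + γ) = inner ℝ h (app X βs) - a - γ * (η * ∑ i, βs i) - y :=
    div_mul_cancel₀ _ hD.ne'
  have hinner : inner ℝ h (app X βs) - inner ℝ h u ≤ ‖h‖ * ε := by
    rw [← inner_sub_right]
    refine (real_inner_le_norm _ _).trans (mul_le_mul_of_nonneg_left ?_ (norm_nonneg h))
    rw [← dist_eq_norm, dist_comm]
    exact hu.le
  have hshift : radialShift f γ u ≤ ((b + γ * (η * ∑ i, βs i + ε) : ℝ) : EReal) := by
    have hmul : ((-(γ * (η * ∑ i, βs i + ε)) : ℝ) : EReal) ≤ (γ : EReal) * subderiv f u u := by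
      rw [← mul_neg, EReal.coe_mul]
      exact mul_le_mul_of_nonneg_left hsub (EReal.coe_nonneg.2 hγ)
    rw [radialShift, if_neg (by simp [hfu]), hfu]
    refine (EReal.sub_le_sub le_rfl hmul).trans (le_of_eq ?_)
    rw [← EReal.coe_sub, sub_neg_eq_add]
  refine le_trans ?_ (le_iSup (fun u => ((inner ℝ h u : ℝ) : EReal) - radialShift f γ u) u)
  refine le_trans ?_ (EReal.sub_le_sub le_rfl hshift)
  rw [← EReal.coe_sub, EReal.coe_le_coe_iff]
  have := (abs_lt.1 hb).2
  linarith

/-- The lower bound holds for every real `e` that satisfies the polar inequality at `β⋆`. -/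
lemma lowerBound_le_lagr {n p : ℕ} {X : Matrix (Fin n) (Fin p) ℝ} {f : Vec n → EReal}
    (hf : ∀ u, f u ≠ ⊥) {η : ℝ} {βs : Vec p} (hβ : IsLocalSolution f X η βs)
    (hreg : f (app X βs) ≠ ⊤ → IsSubdiffRegularAt f (app X βs)) {γ : ℝ} (hγ : 0 ≤ γ) {h : Vec n}
    (hh : h ∈ effDom (conjugate (radialShift f γ))) {e : ℝ}
    (he : inner ℝ βs (-(app X.transpose h)) ≤ e * ∑ i, βs i) :
    lowerBound f η γ h (e : EReal) βs ≤ lagr f X η βs := by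
  have hobj : objective f X η βs = f (app X βs) + ((η * ∑ i, βs i : ℝ) : EReal) := by
    rw [objective, simplexGauge_of_mem hβ.1, ← EReal.coe_mul]
  rw [lagr, hobj]
  by_cases htop : f (app X βs) = ⊤
  · rw [htop, EReal.top_add_coe, EReal.top_sub_coe]
    exact le_top
  obtain ⟨a, ha⟩ : ∃ a : ℝ, f (app X βs) = (a : EReal) :=
    ⟨_, (EReal.coe_toReal htop (hf _)).symm⟩
  have hconj := le_conjugate_radialShift hβ ha (hreg htop) hγ h
  obtain ⟨A, hA⟩ : ∃ A : ℝ, conjugate (radialShift f γ) h = (A : EReal) :=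
    ⟨_, (EReal.coe_toReal (ne_of_lt hh) (ne_bot_of_le_ne_bot (EReal.coe_ne_bot _) hconj)).symm⟩
  rw [hA, EReal.coe_le_coe_iff, inner_app] at hconj
  rw [inner_neg_right] at he
  rw [lowerBound, hA, ha]
  norm_cast
  linarith

end GaugeReg

theorem mainTheorem5 (n p : ℕ) (X : Matrix (Fin n) (Fin p) ℝ)
    (f : GaugeReg.Vec n → EReal) (hf : ∀ u, f u ≠ ⊥) (η : ℝ) (hη : 0 < η)
    -- the objective is proper (so the problem is feasible) and lower semicontinuous
    (hproper : GaugeReg.IsProper (GaugeReg.objective f X η))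
    (hlsc : LowerSemicontinuous (GaugeReg.objective f X η))
    -- `f` is subdifferentially regular on the part of `col₊(X)` on which it is finite
    (hreg : ∀ u ∈ GaugeReg.colPos X, f u ≠ ⊤ → GaugeReg.IsSubdiffRegularAt f u)
    (hqual : X.rank = n ∨
      (GaugeReg.IsConvexFn f ∧
        ¬ GaugeReg.CanBeSeparated (GaugeReg.effDom f) (Set.range (GaugeReg.app X))))
    (βstar : GaugeReg.Vec p) (hβ : GaugeReg.IsLocalSolution f X η βstar)
    (γ : ℝ) (hγ : γ ∈ Set.Icc (0 : ℝ) 1)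
    (h : GaugeReg.Vec n)
    (hh : h ∈ GaugeReg.effDom (GaugeReg.conjugate (GaugeReg.radialShift f γ))) :
    -- the bound with the polar gauge `r°(-Xᵀh)`
    GaugeReg.lowerBound f η γ h
        (GaugeReg.polarGauge (GaugeReg.simplexGauge p) (-(GaugeReg.app X.transpose h))) βstar
      ≤ GaugeReg.lagr f X η βstar ∧
    -- the bound with the largest entry of `-Xᵀh` (if `p ≥ 1`), which may be negative
    (∀ m : ℝ, IsGreatest (Set.range fun i : Fin p => (-(GaugeReg.app X.transpose h)) i) m →
      GaugeReg.lowerBound f η γ h (m : EReal) βstar ≤ GaugeReg.lagr f X η βstar) := by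
  have hreg' := hreg (GaugeReg.app X βstar) ⟨βstar, hβ.1, rfl⟩
  refine ⟨?_, fun m hm => GaugeReg.lowerBound_le_lagr hf hβ hreg' hγ.1 hh ?_⟩
  · obtain ⟨e, he, hpolar⟩ := GaugeReg.exists_polarGauge_eq_coe (-(GaugeReg.app X.transpose h))
    rw [he]
    exact GaugeReg.lowerBound_le_lagr hf hβ hreg' hγ.1 hh (hpolar βstar hβ.1)
  · rw [PiLp.inner_apply, Finset.mul_sum]
    exact Finset.sum_le_sum fun i _ => mul_le_mul_of_nonneg_right (hm.2 ⟨i, rfl⟩) (hβ.1 i)
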